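/- For $n\ge 1$ let $H(n)=1+\frac12+\cdots+\frac1n$ be the $n$-th harmonic number, and let $\nu_p$ denote the $p$-adic valuation on $\mathbb{Q}$. A prime $p$ is called a Wolstenholme prime if $p$ divides the numerator of the Bernoulli number $B_{p-3}$. Here $\mathbb{N}=\{0,1,2,\dots\}$. Let $p\ge 5$ be a Wolstenholme prime and let $n$ be a positive integer such that $p\nmid n$ and $\nu_p(H(n))\ge 3$. 1. If $\nu_p(H(n))=3$, then $\nu_p(H(pn))=2$, and from there on the valuation drops by one at each step: $\nu_p(H(p^m\cdot pn))=2-m$ for all $m\in\mathbb{N}$. 2. If $\nu_p(H(n))\ge 4$ and there is no $m\in\mathbb{N}$ with $\nu_p(H(p^mn))\le 3$, then $\nu_p(H(p^mn))\ge 2m+4$ for all $m\in\mathbb{N}$. 3. If $\nu_p(H(n))\ge 4$ and there is an $m\in\mathbb{N}$ with $\nu_p(H(p^mn))\le 3$, then there exists $M\in\mathbb{N}$ such that $\nu_p(H(p^Mn))=0$ and, for all $m\in\mathbb{N}$, \[ \begin{cases} \nu_p(H(p^mn))\ge 2m+4 & \text{if } m\le \frac{M-1}{3}-1,\\ \nu_p(H(p^mn))=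 M-m & \text{if } m> \frac{M-1}{3}-1. \end{cases} \] -/

import Mathlib

/-- A Wolstenholme prime: a prime `p` dividing (the numerator of) the Bernoulli number `B_{p-3}`.
For `p = 2, 3` the truncated index is `0` and `B_0 = 1`, so neither is a Wolstenholme prime. -/
def IsWolstenholmePrime (p : ℕ) : Prop :=
  p.Prime ∧ (p : ℤ) ∣ (bernoulli (p - 3)).num

open Finset

/-! ### Sums of inverse powers over the units of `ℤ_[p]` -/

section PadicInverse

variable {p : ℕ} [hp : Fact p.Prime]

/-! Splitting off the multiples of `p` gives `H(pN) = H(N)/p + S(pN)`, with `S` the sum of `1/k`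
over `k` prime to `p`. Everything rests on `p^(2m+3) ∣ S(p^(m+1) n)`. Then `x m = ν_p(H(p^m n))`
drops by exactly one whenever `x m ≤ 2m+3`, and otherwise `x (m+1) ≥ 2m+3`; the three cases are
arithmetic on such sequences.

Pairing `k` with `N - k` reduces the bound on `S` to one on the sum of `1/k^2`, which block
expansion reduces to `p^2 ∣ ∑_{k<p} 1/k^2`. There the hypothesis on `B_{p-3}` enters: Faulhaber's
formula gives `p^2 ∣ ∑ k^(p-3)`, and Voronoi's congruence with multiplier 2 carries this to exponent
`-2`.

Since `Ring.inverse` vanishes on non-units, sums over a full range keep only the `k` prime to `p`.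
-/

theorem PadicInt.isUnit_iff_not_dvd {x : ℤ_[p]} : IsUnit x ↔ ¬ (p : ℤ_[p]) ∣ x := by
  rw [← PadicInt.norm_lt_one_iff_dvd, ← PadicInt.not_isUnit_iff, not_not]

theorem PadicInt.isUnit_natCast_iff {k : ℕ} : IsUnit (k : ℤ_[p]) ↔ ¬ p ∣ k := by
  rw [← not_iff_not, PadicInt.not_isUnit_iff, PadicInt.norm_natCast_lt_one_iff, not_not]

theorem PadicInt.inverse_eq_zero_of_dvd {x : ℤ_[p]} (h : (p : ℤ_[p]) ∣ x) :
    Ring.inverse x = 0 :=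
  Ring.inverse_non_unit _ fun hu => PadicInt.isUnit_iff_not_dvd.1 hu h

/-- No unit hypothesis is needed: as `p ∣ y`, either `x` and `x + y` are both units or both inverses
are 0. Iterating the identity yields the expansions in `y` below. -/
theorem PadicInt.inverse_add {x y : ℤ_[p]} (hy : (p : ℤ_[p]) ∣ y) :
    Ring.inverse (x + y) = Ring.inverse x - y * Ring.inverse x * Ring.inverse (x + y) := by
  by_cases hx : (p : ℤ_[p]) ∣ x
  · rw [PadicInt.inverse_eq_zero_of_dvd hx, PadicInt.inverse_eq_zero_of_dvd (dvd_add hx hy)]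
    ring
  · have hxy : ¬ (p : ℤ_[p]) ∣ x + y := fun h => hx ((dvd_add_left hy).1 h)
    have h1 := Ring.mul_inverse_cancel _ (PadicInt.isUnit_iff_not_dvd.2 hx)
    have h2 := Ring.mul_inverse_cancel _ (PadicInt.isUnit_iff_not_dvd.2 hxy)
    linear_combination Ring.inverse x * h2 - Ring.inverse (x + y) * h1

theorem PadicInt.inverse_neg (x : ℤ_[p]) : Ring.inverse (-x) = -Ring.inverse x := by
  by_cases hx : IsUnit x
  · obtain ⟨u, rfl⟩ := hx
    rw [← Units.val_neg, Ring.inverse_unit, Ring.inverse_unit, inv_neg, Units.val_neg]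
  · rw [Ring.inverse_non_unit _ hx, Ring.inverse_non_unit _ (by simpa using hx), neg_zero]

theorem PadicInt.cube_dvd_inverse_add {x y : ℤ_[p]} (hy : (p : ℤ_[p]) ∣ y) :
    y ^ 3 ∣ Ring.inverse (x + y) -
      (Ring.inverse x - y * Ring.inverse x ^ 2 + y ^ 2 * Ring.inverse x ^ 3) := by
  have h := PadicInt.inverse_add (x := x) hy
  generalize Ring.inverse (x + y) = v at *
  generalize Ring.inverse x = u at *
  exact ⟨-(u ^ 3 * v), by linear_combination (1 - y * u + y ^ 2 * u ^ 2) * h⟩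

theorem PadicInt.cube_dvd_inverse_add_sq {x y : ℤ_[p]} (hy : (p : ℤ_[p]) ∣ y) :
    y ^ 3 ∣ Ring.inverse (x + y) ^ 2 -
      (Ring.inverse x ^ 2 - 2 * y * Ring.inverse x ^ 3 + 3 * y ^ 2 * Ring.inverse x ^ 4) := by
  obtain ⟨w, h⟩ := PadicInt.cube_dvd_inverse_add (x := x) hy
  generalize Ring.inverse (x + y) = v at *
  generalize Ring.inverse x = u at *
  -- The first two terms are the tail of the squared expansion of `v`; the last comes from a
  -- difference of squares.
  exact ⟨-2 * u ^ 5 + y * u ^ 6 + w * (v + (u - y * u ^ 2 + y ^ 2 * u ^ 3)),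
    by linear_combination (v + (u - y * u ^ 2 + y ^ 2 * u ^ 3)) * h⟩

theorem sum_range_mul_eq {M : Type*} [AddCommMonoid M] (f : ℕ → M) (L m : ℕ) :
    ∑ k ∈ range (L * m), f k = ∑ j ∈ range m, ∑ i ∈ range L, f (i + L * j) := by
  induction m with
  | zero => simp
  | succ m ih =>
    rw [Nat.mul_succ, sum_range_add, ih, sum_range_succ]
    simp only [add_comm]

/-- Reflection `k ↦ N - k` of a sum over `0 ≤ k < N` whose term at `0` agrees with that at `N`. -/
theorem sum_range_reflect_sub {M : Type*} [AddCommMonoid M] (f : ℕ → M) (N : ℕ)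
    (h : f 0 = f N) : ∑ k ∈ range N, f (N - k) = ∑ k ∈ range N, f k := by
  cases N with
  | zero => simp
  | succ N =>
    rw [sum_range_succ' (fun k => f (N + 1 - k)), sum_range_succ' f, Nat.sub_zero, ← h,
      ← sum_range_reflect]
    congr 1
    refine sum_congr rfl fun k hk => ?_
    rw [mem_range] at hk
    congr 1
    omega

theorem PadicInt.inverse_natCast_sub {N k : ℕ} (hk : k ≤ N) :
    Ring.inverse ((N - k : ℕ) : ℤ_[p]) = -Ring.inverse ((k : ℤ_[p]) + -(N : ℤ_[p])) := by
  rw [← PadicInt.inverse_neg, Nat.cast_sub hk]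
  congr 1
  ring

theorem PadicInt.inverse_zero_eq_inverse {N : ℕ} (hN : p ∣ N) :
    Ring.inverse ((0 : ℕ) : ℤ_[p]) = Ring.inverse ((N : ℕ) : ℤ_[p]) := by
  rw [PadicInt.inverse_eq_zero_of_dvd (Nat.cast_dvd_cast hN), Nat.cast_zero, Ring.inverse_zero]

theorem PadicInt.dvd_of_dvd_two_mul (hp2 : p ≠ 2) {n : ℕ} {x : ℤ_[p]}
    (h : (p : ℤ_[p]) ^ n ∣ 2 * x) : (p : ℤ_[p]) ^ n ∣ x := by
  have h2 : IsUnit ((2 : ℕ) : ℤ_[p]) :=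
    PadicInt.isUnit_natCast_iff.2 fun h =>
      hp2 ((Nat.prime_dvd_prime_iff_eq hp.out Nat.prime_two).1 h)
  exact (h2.dvd_mul_left).1 (by exact_mod_cast h)

/-- The exponent is odd, so the terms at `k` and `N - k` cancel modulo `p`. -/
theorem PadicInt.dvd_sum_inverse_cube (hp2 : p ≠ 2) {N : ℕ} (hN : p ∣ N) :
    (p : ℤ_[p]) ∣ ∑ k ∈ range N, Ring.inverse (k : ℤ_[p]) ^ 3 := by
  rw [← pow_one (p : ℤ_[p])]
  apply PadicInt.dvd_of_dvd_two_mul hp2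
  rw [pow_one, two_mul]
  nth_rw 2 [← sum_range_reflect_sub _ _ (by rw [PadicInt.inverse_zero_eq_inverse hN])]
  rw [← sum_add_distrib]
  refine dvd_sum fun k hk => ?_
  rw [PadicInt.inverse_natCast_sub (mem_range.1 hk).le]
  have hd : (p : ℤ_[p]) ∣ -(N : ℤ_[p]) := (dvd_neg).2 (Nat.cast_dvd_cast hN)
  have h := PadicInt.inverse_add (x := (k : ℤ_[p])) hd
  generalize Ring.inverse ((k : ℤ_[p]) + -(N : ℤ_[p])) = v at *
  generalize Ring.inverse (k : ℤ_[p]) = u at *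
  have : u ^ 3 + (-v) ^ 3 = -(N : ℤ_[p]) * (u * v * (u ^ 2 + u * v + v ^ 2)) := by
    linear_combination -(u ^ 2 + u * v + v ^ 2) * h
  rw [this]
  exact hd.mul_right _

/-- A Wolstenholme-type bound: the sum of `1 / k` over `k < N` prime to `p` gains `p ^ a` over the
sum of `1 / k ^ 2`. -/
theorem PadicInt.pow_dvd_sum_inverse (hp2 : p ≠ 2) {N a : ℕ} (ha : 1 ≤ a) (hN : p ^ a ∣ N)
    (hT : (p : ℤ_[p]) ^ (a + 1) ∣ ∑ k ∈ range N, Ring.inverse (k : ℤ_[p]) ^ 2) :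
    (p : ℤ_[p]) ^ (2 * a + 1) ∣ ∑ k ∈ range N, Ring.inverse (k : ℤ_[p]) := by
  have hpN : p ∣ N := (dvd_pow_self p (by omega)).trans hN
  have hNa : (p : ℤ_[p]) ^ a ∣ (N : ℤ_[p]) := by exact_mod_cast Nat.cast_dvd_cast (α := ℤ_[p]) hN
  have hd : (p : ℤ_[p]) ∣ -(N : ℤ_[p]) := (dvd_neg).2 (Nat.cast_dvd_cast hpN)
  apply PadicInt.dvd_of_dvd_two_mul hp2
  rw [two_mul (Finset.sum _ _)]
  nth_rw 2 [← sum_range_reflect_sub _ _ (PadicInt.inverse_zero_eq_inverse hpN)]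
  rw [← sum_add_distrib]
  -- Expand `1/(N-k) = -1/(k-N)` to second order; the error `N^3` suffices because `3a ≥ 2a+1`.
  have key : (p : ℤ_[p]) ^ (2 * a + 1) ∣ ∑ k ∈ range N,
      (Ring.inverse (k : ℤ_[p]) + Ring.inverse ((N - k : ℕ) : ℤ_[p]) +
        (N * Ring.inverse (k : ℤ_[p]) ^ 2 + N ^ 2 * Ring.inverse (k : ℤ_[p]) ^ 3)) := by
    refine dvd_sum fun k hk => ?_
    rw [PadicInt.inverse_natCast_sub (mem_range.1 hk).le]
    have h := PadicInt.cube_dvd_inverse_add (x := (k : ℤ_[p])) hd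
    have h3 : (p : ℤ_[p]) ^ (2 * a + 1) ∣ (-(N : ℤ_[p])) ^ 3 := by
      rw [Odd.neg_pow (by decide), dvd_neg]
      refine dvd_trans ?_ (pow_dvd_pow_of_dvd hNa 3)
      rw [← pow_mul]
      exact pow_dvd_pow _ (by omega)
    refine (dvd_neg.2 (h3.trans h)).trans (dvd_of_eq ?_)
    ring
  rw [sum_add_distrib] at key
  refine (dvd_add_left ?_).1 key
  rw [sum_add_distrib, ← mul_sum, ← mul_sum]
  refine dvd_add ?_ ?_
  · rw [show 2 * a + 1 = a + (a + 1) by ring, pow_add]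
    exact mul_dvd_mul hNa hT
  · rw [pow_succ, mul_comm 2 a, pow_mul]
    exact mul_dvd_mul (pow_dvd_pow_of_dvd hNa 2) (PadicInt.dvd_sum_inverse_cube hp2 hpN)

/-- Second-order expansion of the sum of `1 / k ^ 2` along blocks of length `p ^ a`. -/
theorem PadicInt.pow_dvd_sum_inverse_sq_blocks {a : ℕ} (ha : 1 ≤ a) (m : ℕ) :
    (p : ℤ_[p]) ^ (3 * a) ∣ ∑ k ∈ range (p ^ a * m), Ring.inverse (k : ℤ_[p]) ^ 2 -
      (m * ∑ i ∈ range (p ^ a), Ring.inverse (i : ℤ_[p]) ^ 2 -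
        2 * p ^ a * (∑ j ∈ range m, (j : ℤ_[p])) *
          ∑ i ∈ range (p ^ a), Ring.inverse (i : ℤ_[p]) ^ 3 +
        3 * p ^ (2 * a) * (∑ j ∈ range m, (j : ℤ_[p]) ^ 2) *
          ∑ i ∈ range (p ^ a), Ring.inverse (i : ℤ_[p]) ^ 4) := by
  have key : (p : ℤ_[p]) ^ (3 * a) ∣ ∑ j ∈ range m, ∑ i ∈ range (p ^ a),
      (Ring.inverse ((i + p ^ a * j : ℕ) : ℤ_[p]) ^ 2 -
        (Ring.inverse (i : ℤ_[p]) ^ 2 - 2 * (p ^ a * j) * Ring.inverse (i : ℤ_[p]) ^ 3 +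
          3 * (p ^ a * j) ^ 2 * Ring.inverse (i : ℤ_[p]) ^ 4)) := by
    refine dvd_sum fun j _ => dvd_sum fun i _ => ?_
    have hd : (p : ℤ_[p]) ∣ p ^ a * j := (dvd_pow_self _ (by omega)).mul_right _
    have h := PadicInt.cube_dvd_inverse_add_sq (x := (i : ℤ_[p])) hd
    push_cast
    refine dvd_trans ?_ h
    rw [mul_pow, ← pow_mul, mul_comm a 3]
    exact dvd_mul_right _ _
  refine key.trans (dvd_of_eq ?_)
  rw [sum_range_mul_eq]
  simp only [sum_sub_distrib, sum_add_distrib, mul_pow, ← mul_sum, ← sum_mul, sum_const, card_range,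
    nsmul_eq_mul]
  ring

/-- Induction on `a`, cutting into `p * n` blocks of length `p^(a+1)`: the number of blocks and the
sums of `j` and `j^2` over `j < p * n` each supply one more factor `p`. The sum of squares requires
6 to be a unit. -/
theorem PadicInt.pow_dvd_sum_inverse_sq (hp5 : 5 ≤ p)
    (hT : (p : ℤ_[p]) ^ 2 ∣ ∑ k ∈ range p, Ring.inverse (k : ℤ_[p]) ^ 2) (a : ℕ) (n : ℕ) :
    (p : ℤ_[p]) ^ (a + 2) ∣ ∑ k ∈ range (p ^ (a + 1) * n), Ring.inverse (k : ℤ_[p]) ^ 2 := by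
  have hp2 : p ≠ 2 := by omega
  induction a generalizing n with
  | zero =>
    have h := PadicInt.pow_dvd_sum_inverse_sq_blocks (p := p) le_rfl n
    have hC := PadicInt.dvd_sum_inverse_cube hp2 (dvd_refl p)
    simp only [pow_one, zero_add, mul_one] at h ⊢
    have h' := (pow_dvd_pow (p : ℤ_[p]) (by norm_num : 2 ≤ 3)).trans h
    refine (dvd_sub_comm.1 h' |> fun h => (dvd_iff_dvd_of_dvd_sub h).1 ?_)
    refine dvd_add (dvd_sub (hT.mul_left _) ?_) ?_
    · rw [pow_two]
      exact mul_dvd_mul ((dvd_mul_left _ _).mul_right _) hC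
    · exact ((dvd_mul_left _ _).mul_right _).mul_right _
  | succ a ih =>
    have h := PadicInt.pow_dvd_sum_inverse_sq_blocks (p := p) (a := a + 1) (by omega) (p * n)
    have hC := PadicInt.dvd_sum_inverse_cube hp2 (N := p ^ (a + 1)) (dvd_pow_self p (by omega))
    have h1 : (p : ℤ_[p]) ∣ ∑ j ∈ range (p * n), (j : ℤ_[p]) := by
      rw [← pow_one (p : ℤ_[p])]
      apply PadicInt.dvd_of_dvd_two_mul hp2
      have := Finset.sum_range_id_mul_two (p * n)
      have h2 : 2 * ∑ j ∈ range (p * n), (j : ℤ_[p]) = ((p * n * (p * n - 1) : ℕ) : ℤ_[p]) := by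
        rw [← this]; push_cast; ring
      rw [h2, pow_one]
      exact Nat.cast_dvd_cast (Dvd.intro _ (by rw [mul_assoc]))
    have h2 : (p : ℤ_[p]) ∣ ∑ j ∈ range (p * n), (j : ℤ_[p]) ^ 2 := by
      have h6 : IsUnit ((6 : ℕ) : ℤ_[p]) := PadicInt.isUnit_natCast_iff.2 fun h => by
        rw [show 6 = 2 * 3 by norm_num, hp.out.dvd_mul] at h
        rcases h with h | h <;> have := Nat.le_of_dvd (by norm_num) h <;> omega
      have hs : ∀ m : ℕ, 6 * ∑ j ∈ range m, (j : ℤ_[p]) ^ 2 = m * ((m - 1) * (2 * m - 1)) := by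
        intro m
        induction m with
        | zero => simp
        | succ m ihm => rw [sum_range_succ, mul_add, ihm]; push_cast; ring
      refine (h6.dvd_mul_left).1 ?_
      have := hs (p * n)
      rw [Nat.cast_ofNat, this, Nat.cast_mul]
      exact (dvd_mul_right _ _).mul_right _
    have hI := ih 1
    rw [mul_one] at hI
    rw [show p ^ (a + 1 + 1) * n = p ^ (a + 1) * (p * n) by ring]
    have h' := (pow_dvd_pow (p : ℤ_[p]) (by omega : a + 1 + 2 ≤ 3 * (a + 1))).trans h
    refine (dvd_sub_comm.1 h' |> fun h => (dvd_iff_dvd_of_dvd_sub h).1 ?_)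
    refine dvd_add (dvd_sub ?_ ?_) ?_
    · rw [show a + 1 + 2 = 1 + (a + 2) by ring, pow_add, pow_one, Nat.cast_mul]
      exact mul_dvd_mul (dvd_mul_right _ _) hI
    · rw [pow_add, pow_two, ← mul_assoc]
      exact mul_dvd_mul (mul_dvd_mul (dvd_mul_left _ _) h1) hC
    · refine Dvd.dvd.mul_right ?_ _
      refine (pow_dvd_pow _ (by omega : a + 1 + 2 ≤ 2 * (a + 1) + 1)).trans ?_
      rw [pow_succ]
      exact mul_dvd_mul (dvd_mul_left _ _) h2

end PadicInverse

/-! ### Bernoulli numbers and power sums modulo `p^2` -/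

section Bernoulli

variable {p : ℕ} [hp : Fact p.Prime]

theorem PadicInt.inv_natCast_mem_subring {k : ℕ} (hk : ¬ p ∣ k) :
    (k : ℚ_[p])⁻¹ ∈ PadicInt.subring p := by
  rw [PadicInt.mem_subring_iff, norm_inv, ← PadicInt.coe_natCast, ← PadicInt.norm_def,
    PadicInt.isUnit_iff.1 (PadicInt.isUnit_natCast_iff.2 hk), inv_one]

theorem PadicInt.exists_coe_eq_of_mem_subring {x : ℚ_[p]} (hx : x ∈ PadicInt.subring p) :
    ∃ w : ℤ_[p], (w : ℚ_[p]) = x :=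
  ⟨⟨x, hx⟩, rfl⟩

/-- The recursion divides only by positive integers at most `n + 1`, hence by units. -/
theorem bernoulli'_mem_subring (n : ℕ) (hn : n + 1 < p) :
    (bernoulli' n : ℚ_[p]) ∈ PadicInt.subring p := by
  induction n using Nat.strong_induction_on with
  | _ n ih =>
    rw [bernoulli'_def]
    push_cast
    refine sub_mem (one_mem _) (sum_mem fun k hk => ?_)
    rw [mem_range] at hk
    refine mul_mem ?_ (ih k hk (by omega))
    rw [div_eq_mul_inv]
    refine mul_mem (natCast_mem _ _) ?_
    have h : ((n : ℚ_[p]) - k + 1) = ((n - k + 1 : ℕ) : ℚ_[p]) := by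
      rw [Nat.cast_add, Nat.cast_sub hk.le, Nat.cast_one]
    rw [h]
    exact PadicInt.inv_natCast_mem_subring (Nat.not_dvd_of_pos_of_lt (by omega) (by omega))

theorem bernoulli_mem_subring (n : ℕ) (hn : n + 1 < p) :
    (bernoulli n : ℚ_[p]) ∈ PadicInt.subring p := by
  rw [bernoulli]
  push_cast
  exact mul_mem (pow_mem (neg_mem (one_mem _)) _) (bernoulli'_mem_subring n hn)

theorem exists_mem_subring_of_dvd_num {q : ℚ} (hq : (p : ℤ) ∣ q.num) :
    ∃ y ∈ PadicInt.subring p, (q : ℚ_[p]) = p * y := by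
  obtain ⟨c, hc⟩ := hq
  have hden : ¬ p ∣ q.den := fun h => by
    have h1 : p ∣ q.num.natAbs := Int.natCast_dvd.1 ⟨c, hc⟩
    exact hp.out.one_lt.ne' (Nat.dvd_one.1 (q.reduced ▸ Nat.dvd_gcd h1 h))
  refine ⟨c * (q.den : ℚ_[p])⁻¹, mul_mem (intCast_mem _ _)
    (PadicInt.inv_natCast_mem_subring hden), ?_⟩
  rw [Rat.cast_def, hc]
  push_cast
  ring

/-- If `p` divides the numerator of `B_e` with `e < p - 1`, then `p ^ 2` divides the sum of
the `e`-th powers below `p`. -/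
theorem PadicInt.sq_dvd_sum_pow_of_dvd_bernoulli {e : ℕ} (he : e + 1 < p)
    (hB : (p : ℤ) ∣ (bernoulli e).num) :
    (p : ℤ_[p]) ^ 2 ∣ ∑ k ∈ range p, (k : ℤ_[p]) ^ e := by
  obtain ⟨y, hy, hBy⟩ := exists_mem_subring_of_dvd_num hB
  have hinv := PadicInt.inv_natCast_mem_subring (p := p) (k := e + 1)
    (Nat.not_dvd_of_pos_of_lt (by omega) he)
  have hz : ∑ i ∈ range e, (bernoulli i : ℚ_[p]) * ((e + 1).choose i : ℕ) *
      (p : ℚ_[p]) ^ (e - 1 - i) * ((e + 1 : ℕ) : ℚ_[p])⁻¹ ∈ PadicInt.subring p :=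
    sum_mem fun i hi => by
      have := mem_range.1 hi
      exact mul_mem (mul_mem (mul_mem (bernoulli_mem_subring i (by omega)) (natCast_mem _ _))
        (pow_mem (natCast_mem _ _) _)) hinv
  obtain ⟨w, hw⟩ := PadicInt.exists_coe_eq_of_mem_subring (add_mem hz hy)
  suffices hsum : ((∑ k ∈ range p, (k : ℤ_[p]) ^ e : ℤ_[p]) : ℚ_[p]) =
      ((p ^ 2 * w : ℤ_[p]) : ℚ_[p]) from ⟨w, PadicInt.ext hsum⟩
  have h := congrArg (fun q : ℚ => (q : ℚ_[p])) (sum_range_pow p e)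
  simp only [Rat.cast_sum, Rat.cast_pow, Rat.cast_natCast] at h
  rw [PadicInt.coe_sum, PadicInt.coe_mul, hw]
  simp only [PadicInt.coe_pow, PadicInt.coe_natCast]
  -- In Faulhaber's formula only the top term `p * B_e` lacks an explicit `p^2`; its second `p`
  -- comes from `B_e`.
  rw [h, sum_range_succ, mul_add, mul_sum]
  congr 1
  · refine sum_congr rfl fun i hi => ?_
    have := mem_range.1 hi
    rw [show e + 1 - i = 2 + (e - 1 - i) by omega, pow_add]
    push_cast
    ring
  · have h0 : (e : ℚ_[p]) + 1 ≠ 0 := by exact_mod_cast Nat.succ_ne_zero e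
    rw [Nat.choose_succ_self_right, Nat.add_sub_cancel_left]
    push_cast
    rw [hBy]
    field_simp

end Bernoulli

/-! ### Voronoi's congruence, transferring exponent `p - 3` to exponent `-2` -/

section Doubling

variable {p : ℕ} [hp : Fact p.Prime]

theorem sum_range_two_mul_mod {M : Type*} [AddCommMonoid M] (hp2 : p ≠ 2) (f : ℕ → M) :
    ∑ i ∈ range p, f (2 * i % p) = ∑ i ∈ range p, f i := by
  have hmaps : Set.MapsTo (fun i => 2 * i % p) (range p) (range p) := fun i _ => by
    simpa using Nat.mod_lt _ hp.out.pos
  have hinj : Set.InjOn (fun i => 2 * i % p) (range p) := fun i hi j hj hij => by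
    have hc : Nat.gcd p 2 = 1 := (Nat.coprime_primes hp.out Nat.prime_two).2 hp2
    have h : i ≡ j [MOD p] := Nat.ModEq.cancel_left_of_coprime hc hij
    exact h.eq_of_lt_of_lt (by simpa using hi) (by simpa using hj)
  exact sum_nbij (fun i => 2 * i % p) hmaps hinj
    (surjOn_of_injOn_of_card_le _ hmaps hinj le_rfl) fun _ _ => rfl

theorem PadicInt.two_mul_eq_mod_add (i : ℕ) :
    (2 * i : ℤ_[p]) = ((2 * i % p : ℕ) : ℤ_[p]) + p * ((2 * i / p : ℕ) : ℤ_[p]) := by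
  exact_mod_cast congrArg (Nat.cast (R := ℤ_[p])) (Nat.mod_add_div (2 * i) p).symm

/-- Voronoi's congruence modulo `p ^ 2` with multiplier `2`. -/
theorem PadicInt.sq_dvd_voronoi (hp2 : p ≠ 2) (e : ℕ) :
    (p : ℤ_[p]) ^ 2 ∣ (2 ^ (e + 1) - 1) * ∑ k ∈ range p, (k : ℤ_[p]) ^ (e + 1) -
      (e + 1) * p * ∑ i ∈ range p,
        ((2 * i / p : ℕ) : ℤ_[p]) * ((2 * i % p : ℕ) : ℤ_[p]) ^ e := by
  have key : (p : ℤ_[p]) ^ 2 ∣ ∑ i ∈ range p, ((2 * i : ℤ_[p]) ^ (e + 1) -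
      ((2 * i % p : ℕ) : ℤ_[p]) ^ (e + 1) -
      (e + 1) * p * (((2 * i / p : ℕ) : ℤ_[p]) * ((2 * i % p : ℕ) : ℤ_[p]) ^ e)) := by
    refine dvd_sum fun i _ => ?_
    rw [PadicInt.two_mul_eq_mod_add]
    generalize ((2 * i % p : ℕ) : ℤ_[p]) = r
    generalize ((2 * i / p : ℕ) : ℤ_[p]) = t
    obtain ⟨c, hc⟩ := Polynomial.binomExpansion (Polynomial.X ^ (e + 1) : Polynomial ℤ_[p]) r (p * t)
    simp at hc
    refine ⟨c * t ^ 2, ?_⟩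
    rw [hc]
    ring
  refine key.trans (dvd_of_eq ?_)
  rw [sum_sub_distrib, sum_sub_distrib, ← mul_sum,
    sum_range_two_mul_mod hp2 fun k => (k : ℤ_[p]) ^ (e + 1)]
  simp only [mul_pow, ← mul_sum]
  ring

/-- The analogue of Voronoi's congruence modulo `p ^ 2` for the exponent `-2`. -/
theorem PadicInt.sq_dvd_voronoi_inverse (hp2 : p ≠ 2) :
    (p : ℤ_[p]) ^ 2 ∣ (Ring.inverse 2 ^ 2 - 1) * ∑ k ∈ range p, Ring.inverse (k : ℤ_[p]) ^ 2 +
      2 * p * ∑ i ∈ range p,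
        ((2 * i / p : ℕ) : ℤ_[p]) * Ring.inverse ((2 * i % p : ℕ) : ℤ_[p]) ^ 3 := by
  have key : (p : ℤ_[p]) ^ 2 ∣ ∑ i ∈ range p, (Ring.inverse (2 * i : ℤ_[p]) ^ 2 -
      Ring.inverse ((2 * i % p : ℕ) : ℤ_[p]) ^ 2 +
      2 * p * (((2 * i / p : ℕ) : ℤ_[p]) * Ring.inverse ((2 * i % p : ℕ) : ℤ_[p]) ^ 3)) := by
    refine dvd_sum fun i _ => ?_
    rw [PadicInt.two_mul_eq_mod_add]
    generalize ((2 * i % p : ℕ) : ℤ_[p]) = r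
    generalize ((2 * i / p : ℕ) : ℤ_[p]) = t
    obtain ⟨c, hc⟩ := PadicInt.cube_dvd_inverse_add_sq (x := r) (dvd_mul_right (p : ℤ_[p]) t)
    exact ⟨c * p * t ^ 3 + 3 * t ^ 2 * Ring.inverse r ^ 4, by linear_combination hc⟩
  refine key.trans (dvd_of_eq ?_)
  rw [sum_add_distrib, sum_sub_distrib, ← mul_sum,
    sum_range_two_mul_mod hp2 fun k => Ring.inverse (k : ℤ_[p]) ^ 2]
  simp only [Ring.mul_inverse_rev, mul_pow, ← sum_mul]
  ring

/-- Fermat's little theorem for `r` prime to `p`; otherwise both terms vanish modulo `p`, since `p -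
4 > 0`. -/
theorem PadicInt.dvd_inverse_cube_sub_pow (hp5 : 5 ≤ p) (r : ℕ) :
    (p : ℤ_[p]) ∣ Ring.inverse (r : ℤ_[p]) ^ 3 - (r : ℤ_[p]) ^ (p - 4) := by
  by_cases hr : p ∣ r
  · have h : (p : ℤ_[p]) ∣ r := Nat.cast_dvd_cast hr
    rw [PadicInt.inverse_eq_zero_of_dvd h]
    exact dvd_sub (by simp) (dvd_pow h (by omega))
  · have hu := Ring.mul_inverse_cancel _ (PadicInt.isUnit_natCast_iff (p := p).2 hr)
    have hf : (p : ℤ) ∣ (r : ℤ) ^ (p - 1) - 1 :=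
      (Int.ModEq.pow_card_sub_one_eq_one hp.out
        (Nat.isCoprime_iff_coprime.2 ((Nat.Prime.coprime_iff_not_dvd hp.out).2 hr).symm)).symm.dvd
    have hf' : (p : ℤ_[p]) ∣ (r : ℤ_[p]) ^ (p - 1) - 1 := by
      have := map_dvd (Int.castRingHom ℤ_[p]) hf
      simpa using this
    obtain ⟨c, hc⟩ := hf'
    refine ⟨-(c * Ring.inverse (r : ℤ_[p]) ^ 3), ?_⟩
    rw [show p - 1 = p - 4 + 3 by omega, pow_add] at hc
    generalize Ring.inverse (r : ℤ_[p]) = u at *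
    generalize (r : ℤ_[p]) = x at *
    have h3 : x ^ 3 * u ^ 3 = 1 := by rw [← mul_pow, hu, one_pow]
    linear_combination -u ^ 3 * hc + x ^ (p - 4) * h3

/-- Both Voronoi congruences carry a factor `p` on their right-hand sums, so these matter only
modulo `p`, where they agree by Fermat. -/
theorem IsWolstenholmePrime.sq_dvd_sum_inverse_sq (hp5 : 5 ≤ p) (hW : IsWolstenholmePrime p) :
    (p : ℤ_[p]) ^ 2 ∣ ∑ k ∈ range p, Ring.inverse (k : ℤ_[p]) ^ 2 := by
  have hp2 : p ≠ 2 := by omega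
  have hp0 : (p : ℤ_[p]) ≠ 0 := PadicInt.prime_p.ne_zero
  have h3 : IsUnit ((3 : ℕ) : ℤ_[p]) := PadicInt.isUnit_natCast_iff.2
    (Nat.not_dvd_of_pos_of_lt (by norm_num) (by omega))
  have he : IsUnit ((p - 3 : ℕ) : ℤ_[p]) := PadicInt.isUnit_natCast_iff.2
    (Nat.not_dvd_of_pos_of_lt (by omega) (by omega))
  have h2 := Ring.mul_inverse_cancel _ (PadicInt.isUnit_natCast_iff (p := p).2
    (Nat.not_dvd_of_pos_of_lt two_pos (by omega : 2 < p)))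
  rw [Nat.cast_ofNat] at h2
  have hP := PadicInt.sq_dvd_sum_pow_of_dvd_bernoulli (by omega : p - 3 + 1 < p) hW.2
  have hV := PadicInt.sq_dvd_voronoi hp2 (p - 4)
  rw [show p - 4 + 1 = p - 3 by omega] at hV
  have hX : (p : ℤ_[p]) ∣ ∑ i ∈ range p,
      ((2 * i / p : ℕ) : ℤ_[p]) * ((2 * i % p : ℕ) : ℤ_[p]) ^ (p - 4) := by
    have h := (dvd_sub_right (hP.mul_left _)).1 hV
    have hcast : ((p - 4 : ℕ) : ℤ_[p]) + 1 = ((p - 3 : ℕ) : ℤ_[p]) := by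
      rw [← Nat.cast_succ]; congr 1; omega
    rw [hcast, mul_assoc, he.dvd_mul_left, pow_two] at h
    exact (mul_dvd_mul_iff_left hp0).1 h
  have hY : (p : ℤ_[p]) ∣ ∑ i ∈ range p,
      ((2 * i / p : ℕ) : ℤ_[p]) * Ring.inverse ((2 * i % p : ℕ) : ℤ_[p]) ^ 3 := by
    refine (dvd_iff_dvd_of_dvd_sub ?_).2 hX
    rw [← sum_sub_distrib]
    refine dvd_sum fun i _ => ?_
    rw [← mul_sub]
    exact (PadicInt.dvd_inverse_cube_sub_pow hp5 _).mul_left _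
  have hI := PadicInt.sq_dvd_voronoi_inverse (p := p) hp2
  have h := (dvd_add_left (by rw [pow_two]; exact mul_dvd_mul (dvd_mul_left _ _) hY)).1 hI
  -- The coefficient `1/4 - 1 = -3/4` is a unit because `p ≥ 5`.
  have h4 : (-4 : ℤ_[p]) * ((Ring.inverse 2 ^ 2 - 1) *
      ∑ k ∈ range p, Ring.inverse (k : ℤ_[p]) ^ 2) =
      ((3 : ℕ) : ℤ_[p]) * ∑ k ∈ range p, Ring.inverse (k : ℤ_[p]) ^ 2 := by
    push_cast
    linear_combination -(2 * Ring.inverse (2 : ℤ_[p]) + 1) *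
      (∑ k ∈ range p, Ring.inverse (k : ℤ_[p]) ^ 2) * h2
  exact h3.dvd_mul_left.1 (h4 ▸ h.mul_left (-4))

end Doubling

/-! ### Recursion for the valuations of harmonic numbers -/

section Harmonic

variable {p : ℕ} [hp : Fact p.Prime]

theorem PadicInt.coe_inverse_natCast (k : ℕ) :
    ((Ring.inverse (k : ℤ_[p]) : ℤ_[p]) : ℚ_[p]) = if p ∣ k then 0 else (k : ℚ_[p])⁻¹ := by
  split_ifs with h
  · rw [PadicInt.inverse_eq_zero_of_dvd (Nat.cast_dvd_cast h), PadicInt.coe_zero]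
  · refine eq_inv_of_mul_eq_one_right ?_
    rw [← PadicInt.coe_natCast, ← PadicInt.coe_mul,
      Ring.mul_inverse_cancel _ (PadicInt.isUnit_natCast_iff.2 h), PadicInt.coe_one]

theorem sum_range_inv_mul_eq (N : ℕ) :
    ∑ k ∈ range (p * N), (k : ℚ_[p])⁻¹ = (∑ k ∈ range N, (k : ℚ_[p])⁻¹) / p +
      ((∑ k ∈ range (p * N), Ring.inverse (k : ℤ_[p]) : ℤ_[p]) : ℚ_[p]) := by
  rw [PadicInt.coe_sum, ← sub_eq_iff_eq_add, ← sum_sub_distrib, sum_range_mul_eq, sum_div]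
  refine sum_congr rfl fun j _ => ?_
  rw [sum_eq_single_of_mem 0 (mem_range.2 hp.out.pos)]
  · rw [PadicInt.coe_inverse_natCast, if_pos (by simp)]
    push_cast
    rw [zero_add, mul_inv, sub_zero]
    ring
  · intro i hi h0
    rw [PadicInt.coe_inverse_natCast, if_neg, sub_self]
    rw [Nat.dvd_add_left (dvd_mul_right p j)]
    exact Nat.not_dvd_of_pos_of_lt (by omega) (mem_range.1 hi)

theorem cast_harmonic_eq (n : ℕ) :
    (harmonic n : ℚ_[p]) = ∑ k ∈ range n, (k : ℚ_[p])⁻¹ + (n : ℚ_[p])⁻¹ := by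
  rw [← sum_range_succ (fun k : ℕ => (k : ℚ_[p])⁻¹), sum_range_succ', harmonic]
  simp

theorem cast_harmonic_mul (N : ℕ) :
    (harmonic (p * N) : ℚ_[p]) = harmonic N / p +
      ((∑ k ∈ range (p * N), Ring.inverse (k : ℤ_[p]) : ℤ_[p]) : ℚ_[p]) := by
  rw [cast_harmonic_eq, cast_harmonic_eq, sum_range_inv_mul_eq]
  push_cast
  rw [mul_inv]
  ring

theorem PadicInt.le_padicValRat_of_pow_dvd {q : ℚ} (hq : q ≠ 0) {x : ℤ_[p]} {n : ℕ}
    (hx : (q : ℚ_[p]) = x) (h : (p : ℤ_[p]) ^ n ∣ x) : (n : ℤ) ≤ padicValRat p q := by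
  have hx0 : x ≠ 0 := by
    rintro rfl
    exact hq (Rat.cast_eq_zero.1 (hx.trans PadicInt.coe_zero))
  rw [← Padic.valuation_ratCast, hx, PadicInt.valuation_coe]
  exact_mod_cast (PadicInt.mem_span_pow_iff_le_valuation x hx0 n).1 (Ideal.mem_span_singleton.2 h)

/-- The difference is the sum over `k` prime to `p`, bounded with `a = m + 1`. Nonvanishing is
required because `padicValRat` takes the value 0 at 0. -/
theorem IsWolstenholmePrime.le_padicValRat_harmonic_sub (hp5 : 5 ≤ p)
    (hW : IsWolstenholmePrime p) (m n : ℕ)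
    (h0 : harmonic (p ^ (m + 1) * n) - harmonic (p ^ m * n) / p ≠ 0) :
    2 * (m : ℤ) + 3 ≤
      padicValRat p (harmonic (p ^ (m + 1) * n) - harmonic (p ^ m * n) / p) := by
  have h := PadicInt.pow_dvd_sum_inverse (p := p) (by omega) (by omega : 1 ≤ m + 1)
    (dvd_mul_right (p ^ (m + 1)) n)
    (PadicInt.pow_dvd_sum_inverse_sq hp5 (hW.sq_dvd_sum_inverse_sq hp5) m n)
  have hc := cast_harmonic_mul (p := p) (p ^ m * n)
  rw [← mul_assoc, ← pow_succ'] at hc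
  have := PadicInt.le_padicValRat_of_pow_dvd h0 (by push_cast; rw [hc, add_sub_cancel_left]) h
  push_cast at this
  linarith

theorem padicValRat_div_prime {q : ℚ} (hq : q ≠ 0) :
    padicValRat p (q / p) = padicValRat p q - 1 := by
  rw [padicValRat.div hq (by exact_mod_cast hp.out.ne_zero), padicValRat.self hp.out.one_lt]

/-- Ultrametric equality: `H(p^m n)/p` has valuation at most `2m+2`, below that of the correction.
-/
theorem IsWolstenholmePrime.padicValRat_harmonic_step_eq (hp5 : 5 ≤ p)
    (hW : IsWolstenholmePrime p) {n : ℕ} (hn : n ≠ 0) (m : ℕ)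
    (h : padicValRat p (harmonic (p ^ m * n)) ≤ 2 * m + 3) :
    padicValRat p (harmonic (p ^ (m + 1) * n)) = padicValRat p (harmonic (p ^ m * n)) - 1 := by
  have hne : ∀ k, harmonic (p ^ k * n) ≠ 0 := fun k =>
    (harmonic_pos (mul_ne_zero (pow_ne_zero _ hp.out.ne_zero) hn)).ne'
  have hpQ : (p : ℚ) ≠ 0 := by exact_mod_cast hp.out.ne_zero
  rw [← padicValRat_div_prime (hne m)]
  by_cases h0 : harmonic (p ^ (m + 1) * n) - harmonic (p ^ m * n) / p = 0
  · rw [sub_eq_zero.1 h0]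
  · have hD := hW.le_padicValRat_harmonic_sub hp5 m n h0
    rw [← add_sub_cancel (harmonic (p ^ m * n) / p) (harmonic (p ^ (m + 1) * n))]
    refine padicValRat.add_eq_of_lt ?_ (div_ne_zero (hne m) hpQ) h0 ?_
    · rw [add_sub_cancel]; exact hne _
    · rw [padicValRat_div_prime (hne m)]; omega

theorem IsWolstenholmePrime.le_padicValRat_harmonic_step (hp5 : 5 ≤ p)
    (hW : IsWolstenholmePrime p) {n : ℕ} (hn : n ≠ 0) (m : ℕ)
    (h : 2 * (m : ℤ) + 4 ≤ padicValRat p (harmonic (p ^ m * n))) :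
    2 * (m : ℤ) + 3 ≤ padicValRat p (harmonic (p ^ (m + 1) * n)) := by
  have hne : ∀ k, harmonic (p ^ k * n) ≠ 0 := fun k =>
    (harmonic_pos (mul_ne_zero (pow_ne_zero _ hp.out.ne_zero) hn)).ne'
  have hdiv := padicValRat_div_prime (p := p) (hne m)
  by_cases h0 : harmonic (p ^ (m + 1) * n) - harmonic (p ^ m * n) / p = 0
  · rw [sub_eq_zero.1 h0]
    omega
  · have hD := hW.le_padicValRat_harmonic_sub hp5 m n h0
    have hadd := padicValRat.min_le_padicValRat_add (p := p)
      (q := harmonic (p ^ m * n) / p)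
      (r := harmonic (p ^ (m + 1) * n) - harmonic (p ^ m * n) / p)
      (by rw [add_sub_cancel]; exact hne _)
    rw [add_sub_cancel] at hadd
    exact (le_min (by omega) hD).trans hadd

end Harmonic

/-! ### Integer sequences with the drop property -/

section ValuationSequence

/-- The threshold `2m+3` rises while `x` falls, so once below it the sequence stays below. -/
theorem eq_sub_of_step {x : ℕ → ℤ} (hstep : ∀ m : ℕ, x m ≤ 2 * m + 3 → x (m + 1) = x m - 1)
    {a : ℕ} (ha : x a ≤ 2 * a + 3) (k : ℕ) : x (a + k) = x a - k := by
  induction k with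
  | zero => simp
  | succ k ih =>
    rw [← add_assoc, hstep (a + k) (by push_cast; omega), ih]
    push_cast
    ring

theorem exists_le_three_of_step {x : ℕ → ℤ}
    (hstep : ∀ m : ℕ, x m ≤ 2 * m + 3 → x (m + 1) = x m - 1)
    {a : ℕ} (ha : x a ≤ 2 * a + 3) : ∃ m, x m ≤ 3 :=
  ⟨a + (x a).toNat, by rw [eq_sub_of_step hstep ha]; omega⟩

/-- Let `a` be the first index with `x a ≤ 2a+3`. From there `x` falls by one per step, so `M = a +
x a`. As `x a ≥ 2a+1` by `hlow` at `a - 1`, `3a+1 ≤ M ≤ 3a+3`, and so `m ≤ (M-1)/3 - 1`, that is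
`3m+4 ≤ M`, means exactly `m < a`. -/
theorem exists_valuation_drop {x : ℕ → ℤ}
    (hstep : ∀ m : ℕ, x m ≤ 2 * m + 3 → x (m + 1) = x m - 1)
    (hlow : ∀ m : ℕ, 2 * (m : ℤ) + 4 ≤ x m → 2 * (m : ℤ) + 3 ≤ x (m + 1))
    (h0 : 4 ≤ x 0) (hex : ∃ m, x m ≤ 3) :
    ∃ M : ℕ, x M = 0 ∧ ∀ m : ℕ,
      ((m : ℚ) ≤ ((M : ℚ) - 1) / 3 - 1 → 2 * (m : ℤ) + 4 ≤ x m) ∧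
      (((M : ℚ) - 1) / 3 - 1 < (m : ℚ) → x m = (M : ℤ) - (m : ℤ)) := by
  classical
  have hex' : ∃ m : ℕ, x m ≤ 2 * m + 3 := hex.imp fun m hm => by omega
  obtain ⟨a, ha, hmin⟩ : ∃ a : ℕ, x a ≤ 2 * a + 3 ∧ ∀ m < a, 2 * (m : ℤ) + 4 ≤ x m :=
    ⟨Nat.find hex', Nat.find_spec hex', fun m hm => by
      have := Nat.find_min hex' hm
      omega⟩
  have ha0 : a ≠ 0 := by
    rintro rfl
    norm_num at ha
    omega
  obtain ⟨b, rfl⟩ := Nat.exists_eq_succ_of_ne_zero ha0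
  have hb := hlow b (hmin b (by omega))
  have hdrop := eq_sub_of_step hstep ha
  simp only [Nat.succ_eq_add_one] at *
  obtain ⟨v, hv⟩ := Int.eq_ofNat_of_zero_le (show 0 ≤ x (b + 1) by omega)
  refine ⟨b + 1 + v, by rw [hdrop]; omega, fun m => ⟨fun hm => ?_, fun hm => ?_⟩⟩
  · have hm' : ((3 * m + 4 : ℕ) : ℚ) ≤ ((b + 1 + v : ℕ) : ℚ) := by
      push_cast at hm ⊢
      linarith
    rw [Nat.cast_le] at hm'
    exact hmin m (by push_cast at ha; omega)
  · have hm' : ((b + 1 + v : ℕ) : ℚ) < ((3 * m + 4 : ℕ) : ℚ) := by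
      push_cast at hm ⊢
      linarith
    rw [Nat.cast_lt] at hm'
    obtain ⟨k, rfl⟩ := Nat.exists_eq_add_of_le (show b + 1 ≤ m by omega)
    rw [hdrop]
    push_cast
    omega

end ValuationSequence

theorem mainTheorem2 (p n : ℕ) (hp5 : 5 ≤ p) (hp : IsWolstenholmePrime p) (hpn : ¬ p ∣ n)
    (hn : 3 ≤ padicValRat p (harmonic n)) :
    (padicValRat p (harmonic n) = 3 →
      padicValRat p (harmonic (p * n)) = 2 ∧
        ∀ m : ℕ, padicValRat p (harmonic (p ^ m * (p * n))) = 2 - (m : ℤ)) ∧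
    (4 ≤ padicValRat p (harmonic n) →
      (¬ ∃ m : ℕ, padicValRat p (harmonic (p ^ m * n)) ≤ 3) →
        ∀ m : ℕ, 2 * (m : ℤ) + 4 ≤ padicValRat p (harmonic (p ^ m * n))) ∧
    (4 ≤ padicValRat p (harmonic n) →
      (∃ m : ℕ, padicValRat p (harmonic (p ^ m * n)) ≤ 3) →
        ∃ M : ℕ, padicValRat p (harmonic (p ^ M * n)) = 0 ∧
          ∀ m : ℕ,
            ((m : ℚ) ≤ ((M : ℚ) - 1) / 3 - 1 →
              2 * (m : ℤ) + 4 ≤ padicValRat p (harmonic (p ^ m * n))) ∧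
            (((M : ℚ) - 1) / 3 - 1 < (m : ℚ) →
              padicValRat p (harmonic (p ^ m * n)) = (M : ℤ) - (m : ℤ))) := by
  have : Fact p.Prime := ⟨hp.1⟩
  have hn0 : n ≠ 0 := by
    rintro rfl
    exact hpn (dvd_zero p)
  have hstep := fun m => hp.padicValRat_harmonic_step_eq hp5 hn0 m
  have hlow := fun m => hp.le_padicValRat_harmonic_step hp5 hn0 m
  refine ⟨fun h3 => ?_, fun _ hno m => ?_, fun h4 hex => ?_⟩
  · have hdrop : ∀ m : ℕ, padicValRat p (harmonic (p ^ m * (p * n))) = 2 - (m : ℤ) := fun m => by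
      have h := eq_sub_of_step (x := fun m => padicValRat p (harmonic (p ^ m * n))) hstep
        (a := 0) (by simp [h3]) (m + 1)
      simp only [zero_add, pow_zero, one_mul, h3] at h
      rw [← mul_assoc, ← pow_succ, h]
      push_cast
      ring
    exact ⟨by simpa using hdrop 0, hdrop⟩
  -- One index with `x m ≤ 2m+3` would start an endless descent and bring some value to 3 or less.
  · by_contra hlt
    exact hno (exists_le_three_of_step (x := fun m => padicValRat p (harmonic (p ^ m * n))) hstep
      (a := m) (by omega))
  · exact exists_valuation_drop (x := fun m => padicValRat p (harmonic (p ^ m * n))) hstep hlow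
      (by simpa using h4) hex
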